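/- For integers $n\ge 0$ and $k\ge 1$ let ${n \brace r}_{\le k}$ be the number of partitions of an $n$-element set into exactly $r$ non-empty blocks, none of which has more than $k$ elements, and let $B_{n,\le k}=\sum_{r=0}^{n}{n \brace r}_{\le k}$ be the restricted Bell numbers. (a) Let $f(i,j)=2+j+\binom{i-1}{2}$. For all integers $n,m\ge 0$ and $k\ge 1$, let $X$ be the set of all vectors $(a_1,a_2,\dots,a_{1+k+\binom{k-1}{2}})$ of non-negative integers such that $$a_1+\sum_{i=2}^{k}\sum_{j=1}^{i-1} j\,a_{f(i,j)}=n\quad\text{and}\quad a_2+\sum_{i=2}^{k}\sum_{j=1}^{i-1}(i-j)\,a_{f(i,j)}=m .$$ Then $X$ is finite and $$B_{n+m,\le k}=n!\,m!\sum_{(a_1,a_2,\dots)\in X}\frac{B_{a_1,\le k}\,B_{a_2,\le k}}{a_1!\,a_2!\,\prod_{i=2}^{k}\prod_{j=1}^{i-1} j!^{\,a_{f(i,j)}}\,(i-j)!^{\,a_{f(i,j)}}\,a_{f(i,j)}!}.$$ (b) For all integers $n,m\ge 0$, writing $a_l(i,j)=\frac13(2i-j-l)$, $$B_{n+m,\le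 3}=\sum_{i=0}^{n}\binom{n}{i}B_{n-i,\le 3}\sum_{j=\lceil i/2\rceil}^{\min\{m,2i\}}\binom{m}{j}B_{m-j,\le 3}\sum_{\substack{0\le l\le \min\{i,j,2i-j,2j-i\}\\ l\equiv -i-j \bmod 3}}\binom{i}{l}\binom{j}{l}\,l!\,\binom{i-l}{a_l(j,i)}\binom{j-l}{a_l(i,j)}\frac{(2a_l(i,j))!\,(2a_l(j,i))!}{2^{a_l(i,j)+a_l(j,i)}}$$ and $$B_{n+m,\le 3}=\sum_{i=0}^{n}\ \sum_{j=\lceil i/2\rceil}^{\min\{m,2i\}}\ \sum_{\substack{0\le l\le \min\{i,j,2i-j,2j-i\}\\ l\equiv -i-j \bmod 3}}\frac{n!\,m!\,B_{n-i,\le 3}\,B_{m-j,\le 3}}{l!\,(n-i)!\,(m-j)!\,a_l(i,j)!\,a_l(j,i)!\,2^{(i+j-2l)/3}} .$$ -/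

import Mathlib

open scoped Nat

/-- The restricted Stirling number of the second kind: the number of partitions of an `n`-element
set into exactly `r` (non-empty) blocks, none of which has more than `k` elements. -/
noncomputable def restrictedStirling (n r k : ℕ) : ℕ :=
  Nat.card {P : Finpartition (Finset.univ : Finset (Fin n)) //
    P.parts.card = r ∧ ∀ b ∈ P.parts, b.card ≤ k}

/-- The restricted Bell number `B_{n, ≤ k}`, the sum over `r = 0, …, n` of the restricted Stirling
numbers of the second kind. -/
noncomputable def restrictedBell (n k : ℕ) : ℕ :=
  ∑ r ∈ Finset.range (n + 1), restrictedStirling n r k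

/-- The index `f(i, j) = 2 + j + binom(i - 1, 2)`; it is used only for `i ≥ 2`. -/
def typeIndex (i j : ℕ) : ℕ := 2 + j + (i - 1).choose 2

/-- The set of vectors `(a_1, …, a_N)` of natural numbers, `N = 1 + k + binom(k - 1, 2)`, such that
`a_1 + ∑_{i=2}^{k} ∑_{j=1}^{i-1} j a_{f(i,j)} = n` and
`a_2 + ∑_{i=2}^{k} ∑_{j=1}^{i-1} (i - j) a_{f(i,j)} = m`.
A vector is a function on `ℕ` that vanishes outside the positions `1, …, N`. -/
def typeVectors (n m k : ℕ) : Set (ℕ → ℕ) :=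
  {a | (∀ p, p ∉ Finset.Icc 1 (1 + k + (k - 1).choose 2) → a p = 0) ∧
    a 1 + ∑ i ∈ Finset.Icc 2 k, ∑ j ∈ Finset.Icc 1 (i - 1), j * a (typeIndex i j) = n ∧
    a 2 + ∑ i ∈ Finset.Icc 2 k, ∑ j ∈ Finset.Icc 1 (i - 1), (i - j) * a (typeIndex i j) = m}

/-- The range of the innermost index `l`: all `0 ≤ l ≤ min {i, j, 2i - j, 2j - i}` with
`l ≡ -i - j (mod 3)`. It is used only for `i ≤ 2j` and `j ≤ 2i`. -/
def tripleRange (i j : ℕ) : Finset ℕ :=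
  (Finset.Icc 0 (min (min i j) (min (2 * i - j) (2 * j - i)))).filter
    fun l => (l : ℤ) ≡ -(i : ℤ) - (j : ℤ) [ZMOD 3]

/-- The number `(2i - j - l) / 3`. For `i ≤ 2j`, `j ≤ 2i` and `l` in `tripleRange i j`, both
`2i - j - l` and `2j - i - l` are non-negative multiples of `3`, so that neither the subtraction
nor the division of natural numbers truncates. -/
def tripleCount (l i j : ℕ) : ℕ := (2 * i - j - l) / 3

/-- The natural number operations in `tripleCount` are exact where it is used. -/
theorem tripleCount_exact {i j l : ℕ} (hij : i ≤ 2 * j) (hji : j ≤ 2 * i)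
    (hl : l ∈ tripleRange i j) :
    (tripleCount l i j : ℚ) = (2 * (i : ℚ) - j - l) / 3 ∧
      (tripleCount l j i : ℚ) = (2 * (j : ℚ) - i - l) / 3 ∧
      (((i + j - 2 * l) / 3 : ℕ) : ℚ) = ((i : ℚ) + j - 2 * l) / 3 := by
  obtain ⟨hl1, hl2⟩ := Finset.mem_filter.mp hl
  have hl3 := (Finset.mem_Icc.mp hl1).2
  simp only [Int.ModEq] at hl2
  simp only [le_min_iff] at hl3
  have h1 : 3 * tripleCount l i j + j + l = 2 * i := by unfold tripleCount; omega
  have h2 : 3 * tripleCount l j i + i + l = 2 * j := by unfold tripleCount; omega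
  have h3 : 3 * ((i + j - 2 * l) / 3) + 2 * l = i + j := by omega
  have h1' : 3 * (tripleCount l i j : ℚ) + j + l = 2 * i := by exact_mod_cast h1
  have h2' : 3 * (tripleCount l j i : ℚ) + i + l = 2 * j := by exact_mod_cast h2
  have h3' : 3 * (((i + j - 2 * l) / 3 : ℕ) : ℚ) + 2 * l = i + j := by exact_mod_cast h3
  refine ⟨?_, ?_, ?_⟩ <;> linarith

/-- The partitions of the finite set `s` whose blocks have at most `k` elements. -/
def boundedFinpartitions {α : Type*} [DecidableEq α] (s : Finset α) (k : ℕ) :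
    Finset (Finpartition s) :=
  Finset.univ.filter fun P => ∀ b ∈ P.parts, b.card ≤ k

theorem mem_boundedFinpartitions {α : Type*} [DecidableEq α] {s : Finset α} {k : ℕ}
    {P : Finpartition s} : P ∈ boundedFinpartitions s k ↔ ∀ b ∈ P.parts, b.card ≤ k := by
  simp [boundedFinpartitions]

/-- Removing the block of `P` that contains `a`. -/
theorem Finpartition.sup_erase_part {α : Type*} [DecidableEq α] {s : Finset α}
    (P : Finpartition s) {b : Finset α} (hb : b ∈ P.parts) :
    (P.parts.erase b).sup id = s \ b := by
  have h1 : b ⊔ (P.parts.erase b).sup id = s := by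
    have := P.sup_parts
    rw [← Finset.insert_erase hb, Finset.sup_insert] at this
    exact this
  have h2 : Disjoint b ((P.parts.erase b).sup id) :=
    P.supIndep (Finset.erase_subset _ _) hb (Finset.notMem_erase _ _)
  calc (P.parts.erase b).sup id = (b ⊔ (P.parts.erase b).sup id) \ b :=
        h2.sup_sdiff_cancel_left.symm
    _ = s \ b := by rw [h1]

theorem card_boundedFinpartitions_insert {α : Type*} [DecidableEq α] {s : Finset α} {a : α}
    (ha : a ∉ s) (k : ℕ) :
    (boundedFinpartitions (insert a s) k).card =
      ∑ u ∈ s.powerset with u.card < k, (boundedFinpartitions (s \ u) k).card := by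
  have has : a ∈ insert a s := Finset.mem_insert_self a s
  rw [Finset.card_eq_sum_card_fiberwise (f := fun P => (P.part a).erase a)
    (t := s.powerset.filter fun u => u.card < k)]
  · refine Finset.sum_congr rfl fun u hu => ?_
    obtain ⟨hus, huk⟩ := Finset.mem_filter.mp hu
    rw [Finset.mem_powerset] at hus
    have hau : a ∉ u := fun h => ha (hus h)
    have hsd : insert a s \ insert a u = s \ u := by
      ext x
      simp only [Finset.mem_sdiff, Finset.mem_insert]
      constructor
      · tauto
      · rintro ⟨hx, hxu⟩
        refine ⟨Or.inr hx, ?_⟩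
        rintro (rfl | h)
        exacts [ha hx, hxu h]
    have hpart : ∀ P : Finpartition (insert a s), (P.part a).erase a = u →
        P.part a = insert a u := by
      rintro P rfl
      exact (Finset.insert_erase (P.mem_part_self.mpr has)).symm
    have hdisj : ∀ Q : Finpartition (s \ u), insert a u ∉ Q.parts := fun Q h => by
      have := Q.subset h (Finset.mem_insert_self a u)
      exact ha (Finset.mem_sdiff.mp this).1
    refine Finset.card_bij'
      (fun P hP => P.ofSubset (Finset.erase_subset (insert a u) P.parts) ?_)
      (fun Q _ => Q.extend (b := insert a u) (c := insert a s)
        (Finset.insert_ne_empty a u) ?_ ?_) ?_ ?_ ?_ ?_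
    · have hp := hpart P (Finset.mem_filter.mp hP).2
      rw [P.sup_erase_part (hp ▸ P.part_mem.mpr has), hsd]
    · rw [← hsd]; exact Finset.sdiff_disjoint
    · rw [← hsd]
      exact Finset.sdiff_union_of_subset (Finset.insert_subset_insert a hus)
    · intro P hP
      rw [mem_boundedFinpartitions]
      intro b hb
      exact mem_boundedFinpartitions.mp (Finset.mem_filter.mp hP).1 b (Finset.mem_of_mem_erase hb)
    · intro Q hQ
      rw [Finset.mem_filter, mem_boundedFinpartitions]
      refine ⟨fun b hb => ?_, ?_⟩
      · rcases Finset.mem_insert.mp hb with rfl | hb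
        · rw [Finset.card_insert_of_notMem hau]; omega
        · exact mem_boundedFinpartitions.mp hQ b hb
      · rw [Finpartition.part_eq_of_mem _ (t := insert a u) (Finset.mem_insert_self _ _)
          (Finset.mem_insert_self _ _), Finset.erase_insert hau]
    · intro P hP
      have hp := hpart P (Finset.mem_filter.mp hP).2
      ext1
      exact Finset.insert_erase (hp ▸ P.part_mem.mpr has)
    · intro Q hQ
      ext1
      exact Finset.erase_insert (hdisj Q)
  · intro P hP
    have hP' := mem_boundedFinpartitions.mp hP
    have hm := P.mem_part_self.mpr has
    simp only [Finset.coe_filter, Finset.mem_powerset, Set.mem_ofPred_eq]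
    constructor
    · exact Finset.subset_insert_iff.mp (P.part_subset a)
    · rw [Finset.card_erase_of_mem hm]
      have := hP' _ (P.part_mem.mpr has)
      have := Finset.card_pos.mpr ⟨a, hm⟩
      omega

theorem sum_powerset_card_lt {α : Type*} (s : Finset α) (k : ℕ) (f : ℕ → ℕ) :
    ∑ u ∈ s.powerset with u.card < k, f u.card =
      ∑ j ∈ Finset.range k, s.card.choose j * f j := by
  rw [Finset.sum_filter, Finset.sum_powerset_apply_card (fun j => if j < k then f j else 0)]
  simp only [smul_eq_mul, mul_ite, mul_zero]
  rw [← Finset.sum_filter]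
  refine Finset.sum_subset_zero_on_sdiff ?_ ?_ fun _ _ => rfl
  · intro j hj
    simp at hj ⊢; exact hj.2
  · intro j hj
    simp only [Finset.mem_sdiff, Finset.mem_range, Finset.mem_filter, not_and] at hj
    rw [Nat.choose_eq_zero_of_lt (by by_contra h; exact hj.2 (by omega) hj.1), zero_mul]

theorem card_boundedFinpartitions_empty (α : Type*) [DecidableEq α] (k : ℕ) :
    (boundedFinpartitions (∅ : Finset α) k).card = 1 := by
  rw [Finset.card_eq_one]
  refine ⟨Finpartition.empty _, ?_⟩
  ext P
  have hP : P = Finpartition.empty (Finset α) :=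
    Subsingleton.elim (α := Finpartition (⊥ : Finset α)) _ _
  rw [mem_boundedFinpartitions, Finset.mem_singleton]
  refine ⟨fun _ => hP, fun _ b hb => ?_⟩
  rw [hP] at hb
  exact absurd hb (Finset.notMem_empty b)

theorem card_boundedFinpartitions_eq_range (k n : ℕ) :
    ∀ {α : Type} [DecidableEq α] (s : Finset α), s.card = n →
      (boundedFinpartitions s k).card = (boundedFinpartitions (Finset.range n) k).card := by
  induction n using Nat.strong_induction_on with
  | _ n ih =>
    have key : ∀ {α : Type} [DecidableEq α] (s : Finset α) (a : α), a ∉ s → s.card + 1 = n →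
        (boundedFinpartitions (insert a s) k).card = ∑ j ∈ Finset.range k,
          s.card.choose j * (boundedFinpartitions (Finset.range (s.card - j)) k).card := by
      intro α _ s a ha hs
      rw [card_boundedFinpartitions_insert ha, ← sum_powerset_card_lt s k
        (fun j => (boundedFinpartitions (Finset.range (s.card - j)) k).card)]
      refine Finset.sum_congr rfl fun u hu => ?_
      have hu' := Finset.mem_powerset.mp (Finset.mem_filter.mp hu).1
      exact ih _ (by omega) _ (Finset.card_sdiff_of_subset hu')
    intro α _ s hs
    rcases n with _ | n
    · rw [Finset.card_eq_zero] at hs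
      subst hs
      rw [Finset.range_zero]
      rw [card_boundedFinpartitions_empty, card_boundedFinpartitions_empty]
    · obtain ⟨a, t, ha, rfl, ht⟩ := Finset.card_eq_succ.mp hs
      rw [key t a ha (by omega), Finset.range_add_one,
        key _ _ Finset.notMem_range_self (by simp), Finset.card_range, ht]

theorem restrictedBell_eq_card (n k : ℕ) :
    restrictedBell n k = (boundedFinpartitions (Finset.range n) k).card := by
  rw [← card_boundedFinpartitions_eq_range k n (Finset.univ : Finset (Fin n)) (by simp),
    Finset.card_eq_sum_card_fiberwise (f := fun P => P.parts.card) (t := Finset.range (n + 1))]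
  · refine Finset.sum_congr rfl fun r _ => ?_
    rw [restrictedStirling, Nat.card_eq_fintype_card, Fintype.card_subtype]
    congr 1
    ext P
    simp [mem_boundedFinpartitions, and_comm]
  · intro P _
    have := P.card_parts_le_card
    simp at this ⊢
    omega

theorem restrictedBell_zero (k : ℕ) : restrictedBell 0 k = 1 := by
  rw [restrictedBell_eq_card, Finset.range_zero, card_boundedFinpartitions_empty]

theorem restrictedBell_succ (n k : ℕ) :
    restrictedBell (n + 1) k =
      ∑ j ∈ Finset.range k, n.choose j * restrictedBell (n - j) k := by
  rw [restrictedBell_eq_card, Finset.range_add_one,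
    card_boundedFinpartitions_insert Finset.notMem_range_self]
  have := sum_powerset_card_lt (Finset.range n) k (fun j => restrictedBell (n - j) k)
  rw [Finset.card_range] at this
  rw [← this]
  refine Finset.sum_congr rfl fun u hu => ?_
  have hu' := Finset.mem_powerset.mp (Finset.mem_filter.mp hu).1
  rw [restrictedBell_eq_card]
  refine card_boundedFinpartitions_eq_range k _ _ ?_
  rw [Finset.card_sdiff_of_subset hu', Finset.card_range]

/-- The vectors of natural numbers supported in `V` with `∑ α p * a p = n` and
`∑ β p * a p = m`, provided that `α` and `β` have no common zero in `V`. -/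
noncomputable def linearSolutions (V : Finset ℕ) (α β : ℕ → ℕ) (n m : ℕ) : Finset (ℕ → ℕ) :=
  open Classical in
  ((V.finsupp fun _ => Finset.range (n + m + 1)).image fun a : ℕ →₀ ℕ => (⇑a : ℕ → ℕ)).filter
    fun a => ∑ p ∈ V, α p * a p = n ∧ ∑ p ∈ V, β p * a p = m

section LinearSolutions

variable {V : Finset ℕ} {α β : ℕ → ℕ}

theorem mem_linearSolutions (hV : ∀ p ∈ V, 1 ≤ α p + β p) {n m : ℕ} {a : ℕ → ℕ} :
    a ∈ linearSolutions V α β n m ↔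
      (∀ p, p ∉ V → a p = 0) ∧ ∑ p ∈ V, α p * a p = n ∧ ∑ p ∈ V, β p * a p = m := by
  classical
  simp only [linearSolutions, Finset.mem_filter, Finset.mem_image, Finset.mem_finsupp_iff]
  refine and_congr_left fun h => ⟨?_, fun h0 => ?_⟩
  · rintro ⟨a, ⟨ha, -⟩, rfl⟩ p hp
    exact Finsupp.notMem_support_iff.mp fun h => hp (ha h)
  · refine ⟨Finsupp.onFinset V a fun p hp => by by_contra h; exact hp (h0 p h),
      ⟨Finsupp.support_onFinset_subset, fun p hp => ?_⟩, rfl⟩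
    have h1 : α p * a p ≤ n :=
      h.1 ▸ Finset.single_le_sum (f := fun p => α p * a p) (fun _ _ => Nat.zero_le _) hp
    have h2 : β p * a p ≤ m :=
      h.2 ▸ Finset.single_le_sum (f := fun p => β p * a p) (fun _ _ => Nat.zero_le _) hp
    have h3 : 1 * a p ≤ (α p + β p) * a p := Nat.mul_le_mul_right _ (hV p hp)
    rw [Finset.mem_range, Finsupp.onFinset_apply]
    linarith

theorem sum_mul_add_single {p : ℕ} (hp : p ∈ V) (γ a : ℕ → ℕ) (t : ℕ) :
    ∑ q ∈ V, γ q * (a + Pi.single p t : ℕ → ℕ) q = ∑ q ∈ V, γ q * a q + t * γ p := by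
  simp only [Pi.add_apply, mul_add, Finset.sum_add_distrib]
  congr 1
  rw [Finset.sum_eq_single p (by intro q _ hq; simp [hq]) (fun h => absurd hp h)]
  simp [mul_comm]

theorem sum_linearSolutions_le (hV : ∀ p ∈ V, 1 ≤ α p + β p) {p : ℕ} (hp : p ∈ V)
    (n m t : ℕ) (g : (ℕ → ℕ) → ℚ) :
    ∑ a ∈ linearSolutions V α β n m with t ≤ a p, g a =
      if t * α p ≤ n ∧ t * β p ≤ m then
        ∑ a ∈ linearSolutions V α β (n - t * α p) (m - t * β p), g (a + Pi.single p t)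
      else 0 := by
  have hsub : ∀ a : ℕ → ℕ, t ≤ a p → a - Pi.single p t + Pi.single p t = a := by
    intro a ha
    refine tsub_add_cancel_of_le fun q => ?_
    rcases eq_or_ne q p with rfl | hq
    · simpa using ha
    · simp [hq]
  have hsum : ∀ (a γ : ℕ → ℕ), t ≤ a p →
      ∑ q ∈ V, γ q * (a - Pi.single p t : ℕ → ℕ) q + t * γ p = ∑ q ∈ V, γ q * a q := by
    intro a γ ha
    rw [← sum_mul_add_single hp γ, hsub a ha]
  split_ifs with h
  · refine Finset.sum_nbij' (fun a => a - Pi.single p t) (fun a => a + Pi.single p t)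
      ?_ ?_ ?_ ?_ ?_
    · intro a ha
      rw [Finset.mem_filter, mem_linearSolutions hV] at ha
      rw [mem_linearSolutions hV]
      obtain ⟨⟨h0, h1, h2⟩, h3⟩ := ha
      have e1 := hsum a α h3
      have e2 := hsum a β h3
      exact ⟨fun q hq => by simp [h0 q hq], by omega, by omega⟩
    · intro a ha
      rw [mem_linearSolutions hV] at ha
      rw [Finset.mem_filter, mem_linearSolutions hV, sum_mul_add_single hp, sum_mul_add_single hp]
      obtain ⟨h0, h1, h2⟩ := ha
      refine ⟨⟨fun q hq => ?_, by omega, by omega⟩, by simp⟩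
      have : q ≠ p := by rintro rfl; exact hq hp
      simp [h0 q hq, this]
    · intro a ha
      exact hsub a (Finset.mem_filter.mp ha).2
    · intro a _
      exact add_tsub_cancel_right a _
    · intro a ha
      simp only [hsub a (Finset.mem_filter.mp ha).2]
  · refine Finset.sum_eq_zero fun a ha => absurd ?_ h
    rw [Finset.mem_filter, mem_linearSolutions hV] at ha
    obtain ⟨⟨h0, h1, h2⟩, h3⟩ := ha
    have e1 := hsum a α h3
    have e2 := hsum a β h3
    constructor <;> omega

/-- The value of `F` at `(n - u, m - v)`, and `0` if that is not a pair of natural numbers. -/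
def shiftedValue (F : ℕ → ℕ → ℚ) (n m u v : ℕ) : ℚ :=
  if u ≤ n ∧ v ≤ m then F (n - u) (m - v) else 0

/-- The total weight of the solutions, for a weight that is a product over the positions. -/
noncomputable def weightedCount (V : Finset ℕ) (α β : ℕ → ℕ) (w : ℕ → ℕ → ℚ) (n m : ℕ) : ℚ :=
  ∑ a ∈ linearSolutions V α β n m, ∏ p ∈ V, w p (a p)

theorem natCast_mul_weightedCount (hV : ∀ p ∈ V, 1 ≤ α p + β p) (k : ℕ) (w c : ℕ → ℕ → ℚ)
    (hw : ∀ p ∈ V, ∀ q : ℕ, (q : ℚ) * w p q =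
      ∑ s ∈ Finset.range k, if s + 1 ≤ q then c p s * w p (q - (s + 1)) else 0) (n m : ℕ) :
    (n : ℚ) * weightedCount V α β w n m =
      ∑ p ∈ V, (α p : ℚ) * ∑ s ∈ Finset.range k,
        c p s * shiftedValue (weightedCount V α β w) n m ((s + 1) * α p) ((s + 1) * β p) := by
  have step : ∀ p ∈ V, ∀ s, ∑ a ∈ linearSolutions V α β n m,
      (if s + 1 ≤ a p then c p s * w p (a p - (s + 1)) else 0) * ∏ q ∈ V.erase p, w q (a q) =
      c p s * shiftedValue (weightedCount V α β w) n m ((s + 1) * α p) ((s + 1) * β p) := by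
    intro p hp s
    simp only [ite_mul, zero_mul]
    rw [← Finset.sum_filter, sum_linearSolutions_le hV hp, shiftedValue, mul_ite, mul_zero]
    refine if_congr Iff.rfl ?_ rfl
    rw [weightedCount, Finset.mul_sum]
    refine Finset.sum_congr rfl fun a _ => ?_
    rw [mul_assoc, ← Finset.mul_prod_erase V _ hp]
    congr 2
    · simp
    · refine Finset.prod_congr rfl fun q hq => ?_
      simp [Finset.ne_of_mem_erase hq]
  calc (n : ℚ) * weightedCount V α β w n m
      = ∑ a ∈ linearSolutions V α β n m, ∑ p ∈ V, (α p : ℚ) *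
          (((a p : ℕ) : ℚ) * w p (a p) * ∏ q ∈ V.erase p, w q (a q)) := by
        rw [weightedCount, Finset.mul_sum]
        refine Finset.sum_congr rfl fun a ha => ?_
        rw [mem_linearSolutions hV] at ha
        rw [← ha.2.1]
        push_cast
        rw [Finset.sum_mul]
        refine Finset.sum_congr rfl fun p hp => ?_
        rw [← Finset.mul_prod_erase V _ hp]
        ring
    _ = _ := by
        rw [Finset.sum_comm]
        refine Finset.sum_congr rfl fun p hp => ?_
        rw [← Finset.mul_sum]
        congr 1
        simp only [hw p hp, Finset.sum_mul]
        rw [Finset.sum_comm]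
        exact Finset.sum_congr rfl fun s _ => step p hp s

end LinearSolutions

theorem eq_of_shiftedValue_recurrence {ι : Type*} (I : Finset ι) (c : ι → ℚ) (u v : ι → ℕ)
    (hu : ∀ i ∈ I, 1 ≤ u i) (F G : ℕ → ℕ → ℚ) (h0 : ∀ m, F 0 m = G 0 m)
    (hF : ∀ n m, ((n + 1 : ℕ) : ℚ) * F (n + 1) m =
      ∑ i ∈ I, c i * shiftedValue F (n + 1) m (u i) (v i))
    (hG : ∀ n m, ((n + 1 : ℕ) : ℚ) * G (n + 1) m =
      ∑ i ∈ I, c i * shiftedValue G (n + 1) m (u i) (v i)) (n m : ℕ) : F n m = G n m := by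
  induction n using Nat.strong_induction_on generalizing m with
  | _ n ih =>
    rcases n with _ | n
    · exact h0 m
    · refine mul_left_cancel₀ (Nat.cast_ne_zero.mpr n.succ_ne_zero : ((n + 1 : ℕ) : ℚ) ≠ 0) ?_
      rw [hF, hG]
      refine Finset.sum_congr rfl fun i hi => ?_
      congr 1
      have := hu i hi
      simp only [shiftedValue]
      split_ifs with h
      · exact ih _ (by omega) _
      · rfl

/-- The pairs `(s, u)` with `u < s < k`; the type `(i, j)` corresponds to `(i - 1, j - 1)`. -/
def typePairs (k : ℕ) : Finset (Σ _ : ℕ, ℕ) :=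
  (Finset.range k).sigma fun s => Finset.range s

theorem mem_typePairs {k : ℕ} {x : Σ _ : ℕ, ℕ} : x ∈ typePairs k ↔ x.1 < k ∧ x.2 < x.1 := by
  simp [typePairs]

@[to_additive]
theorem prod_types {M : Type*} [CommMonoid M] (k : ℕ) (g : ℕ → ℕ → M) :
    ∏ i ∈ Finset.Icc 2 k, ∏ j ∈ Finset.Icc 1 (i - 1), g i j =
      ∏ x ∈ typePairs k, g (x.1 + 1) (x.2 + 1) := by
  rw [Finset.prod_sigma']
  refine Finset.prod_nbij' (fun x => ⟨x.1 - 1, x.2 - 1⟩) (fun x => ⟨x.1 + 1, x.2 + 1⟩)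
    ?_ ?_ ?_ ?_ ?_
  · rintro ⟨i, j⟩ h
    simp only [Finset.mem_sigma, Finset.mem_Icc, mem_typePairs] at h ⊢
    omega
  · rintro ⟨i, j⟩ h
    simp only [Finset.mem_sigma, Finset.mem_Icc, mem_typePairs] at h ⊢
    omega
  · rintro ⟨i, j⟩ h
    simp only [Finset.mem_sigma, Finset.mem_Icc] at h
    rw [Nat.sub_add_cancel (by omega : 1 ≤ i), Nat.sub_add_cancel (by omega : 1 ≤ j)]
  · rintro ⟨i, j⟩ h
    rfl
  · rintro ⟨i, j⟩ h
    simp only [Finset.mem_sigma, Finset.mem_Icc] at h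
    rw [Nat.sub_add_cancel (by omega : 1 ≤ i), Nat.sub_add_cancel (by omega : 1 ≤ j)]

/-- The position of the type that corresponds to a pair. -/
def pairPosition (x : Σ _ : ℕ, ℕ) : ℕ := typeIndex (x.1 + 1) (x.2 + 1)

theorem choose_two_succ (s : ℕ) : (s + 1).choose 2 = s + s.choose 2 := by
  rw [Nat.choose_succ_succ' s 1, Nat.choose_one_right]

theorem pairPosition_eq (x : Σ _ : ℕ, ℕ) : pairPosition x = 3 + x.2 + x.1.choose 2 := by
  simp only [pairPosition, typeIndex, Nat.add_sub_cancel]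
  omega

theorem injOn_pairPosition : Set.InjOn pairPosition {x | x.2 < x.1} := by
  have key : ∀ x y : (Σ _ : ℕ, ℕ), x.2 < x.1 → x.1 < y.1 → pairPosition x < pairPosition y := by
    intro x y hx hxy
    have h1 := choose_two_succ x.1
    have h2 := Nat.choose_le_choose 2 (Nat.succ_le_of_lt hxy)
    rw [Nat.succ_eq_add_one] at h2
    rw [pairPosition_eq, pairPosition_eq]
    omega
  rintro ⟨s, u⟩ hx ⟨t, v⟩ hy h
  rcases lt_trichotomy s t with hst | rfl | hst
  · exact absurd h (key _ _ hx hst).ne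
  · rw [pairPosition_eq, pairPosition_eq] at h
    simp only at h
    rw [show u = v by omega]
  · exact absurd h.symm (key _ _ hy hst).ne

theorem image_pairPosition (k : ℕ) :
    (typePairs k).image pairPosition = Finset.Ico 3 (3 + k.choose 2) := by
  induction k with
  | zero => rfl
  | succ k ih =>
    ext p
    have ih' := Finset.ext_iff.mp ih p
    simp only [Finset.mem_image, mem_typePairs, Finset.mem_Ico, choose_two_succ] at ih' ⊢
    constructor
    · rintro ⟨x, ⟨h1, h2⟩, rfl⟩
      rcases Nat.lt_succ_iff_lt_or_eq.mp h1 with h | h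
      · have := ih'.mp ⟨x, ⟨h, h2⟩, rfl⟩
        omega
      · rw [pairPosition_eq, ← h]
        omega
    · intro hp
      by_cases h : p < 3 + k.choose 2
      · obtain ⟨x, hx, rfl⟩ := ih'.mpr ⟨hp.1, h⟩
        exact ⟨x, ⟨by omega, hx.2⟩, rfl⟩
      · refine ⟨⟨k, p - 3 - k.choose 2⟩, ⟨by simp, by simp only; omega⟩, ?_⟩
        rw [pairPosition_eq]
        simp only
        omega

/-- The pair whose type has a given position. -/
noncomputable def positionPair (p : ℕ) : Σ _ : ℕ, ℕ :=
  Function.invFunOn pairPosition {x | x.2 < x.1} p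

theorem positionPair_pairPosition {x : Σ _ : ℕ, ℕ} (hx : x.2 < x.1) :
    positionPair (pairPosition x) = x :=
  injOn_pairPosition.leftInvOn_invFunOn hx

/-- The positions `1, …, 1 + k + binom(k - 1, 2)` of a vector of types. -/
def typePositions (k : ℕ) : Finset ℕ :=
  insert 1 (insert 2 ((typePairs k).image pairPosition))

theorem typePositions_eq {k : ℕ} (hk : 1 ≤ k) :
    typePositions k = Finset.Icc 1 (1 + k + (k - 1).choose 2) := by
  obtain ⟨k, rfl⟩ := Nat.exists_eq_add_of_le' hk
  ext p
  simp only [typePositions, image_pairPosition, Finset.mem_insert, Finset.mem_Ico,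
    Finset.mem_Icc, choose_two_succ, Nat.add_sub_cancel]
  omega

@[to_additive]
theorem prod_typePositions {M : Type*} [CommMonoid M] (k : ℕ) (g : ℕ → M) :
    ∏ p ∈ typePositions k, g p = g 1 * (g 2 * ∏ x ∈ typePairs k, g (pairPosition x)) := by
  rw [typePositions, Finset.prod_insert, Finset.prod_insert, Finset.prod_image]
  · exact fun x hx y hy h => injOn_pairPosition (mem_typePairs.mp hx).2 (mem_typePairs.mp hy).2 h
  · rw [image_pairPosition]; simp
  · rw [image_pairPosition]; simp

/-- A function of the position that takes given values at `1`, at `2`, and at the types. -/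
noncomputable def byPosition {M : Type*} (x y : M) (g : ℕ → ℕ → M) (p : ℕ) : M :=
  if p = 1 then x else if p = 2 then y else g (positionPair p).1 (positionPair p).2

section byPosition

variable {M : Type*} (y z : M) (g : ℕ → ℕ → M)

theorem byPosition_one : byPosition y z g 1 = y := rfl

theorem byPosition_two : byPosition y z g 2 = z := rfl

theorem byPosition_pairPosition {x : Σ _ : ℕ, ℕ} (hx : x.2 < x.1) :
    byPosition y z g (pairPosition x) = g x.1 x.2 := by
  have h := pairPosition_eq x
  rw [byPosition, if_neg (by omega), if_neg (by omega), positionPair_pairPosition hx]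

end byPosition

theorem forall_mem_typePositions {k : ℕ} {P : ℕ → Prop} :
    (∀ p ∈ typePositions k, P p) ↔ P 1 ∧ P 2 ∧ ∀ x ∈ typePairs k, P (pairPosition x) := by
  simp only [typePositions, Finset.forall_mem_insert, Finset.forall_mem_image]

/-- The coefficient of a position in the first equation of `typeVectors`. -/
noncomputable def leftDegree : ℕ → ℕ := byPosition 1 0 fun _ u => u + 1

/-- The coefficient of a position in the second equation of `typeVectors`. -/
noncomputable def rightDegree : ℕ → ℕ := byPosition 0 1 fun s u => s - u

theorem one_le_degree (k : ℕ) : ∀ p ∈ typePositions k, 1 ≤ leftDegree p + rightDegree p := by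
  rw [forall_mem_typePositions]
  refine ⟨by simp [leftDegree, byPosition_one], by simp [rightDegree, byPosition_two],
    fun x hx => ?_⟩
  rw [leftDegree, byPosition_pairPosition _ _ _ (mem_typePairs.mp hx).2]
  omega

theorem coe_linearSolutions_eq_typeVectors {k : ℕ} (hk : 1 ≤ k) (n m : ℕ) :
    (linearSolutions (typePositions k) leftDegree rightDegree n m : Set (ℕ → ℕ)) =
      typeVectors n m k := by
  ext a
  rw [Finset.mem_coe, mem_linearSolutions (one_le_degree k), typeVectors, Set.mem_ofPred_eq,
    sum_types k fun i j => j * a (typeIndex i j), sum_types k fun i j => (i - j) * a (typeIndex i j),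
    ← typePositions_eq hk, sum_typePositions, sum_typePositions]
  have h1 : ∑ x ∈ typePairs k, leftDegree (pairPosition x) * a (pairPosition x) =
      ∑ x ∈ typePairs k, (x.2 + 1) * a (typeIndex (x.1 + 1) (x.2 + 1)) :=
    Finset.sum_congr rfl fun x hx => by
      rw [leftDegree, byPosition_pairPosition _ _ _ (mem_typePairs.mp hx).2, pairPosition]
  have h2 : ∑ x ∈ typePairs k, rightDegree (pairPosition x) * a (pairPosition x) =
      ∑ x ∈ typePairs k, (x.1 + 1 - (x.2 + 1)) * a (typeIndex (x.1 + 1) (x.2 + 1)) :=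
    Finset.sum_congr rfl fun x hx => by
      rw [rightDegree, byPosition_pairPosition _ _ _ (mem_typePairs.mp hx).2, pairPosition,
        Nat.add_sub_add_right]
  rw [h1, h2]
  simp [leftDegree, rightDegree, byPosition_one, byPosition_two]

/-- The restricted Bell number divided by the factorial. -/
noncomputable def bellCoeff (k n : ℕ) : ℚ := (restrictedBell n k : ℚ) / (n ! : ℚ)

theorem choose_div_factorial {n s : ℕ} (h : s ≤ n) :
    (n.choose s : ℚ) / (n ! : ℚ) = 1 / (s ! : ℚ) / ((n - s)! : ℚ) := by
  rw [Nat.cast_choose ℚ h]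
  have := n.factorial_ne_zero
  field_simp

theorem natCast_mul_bellCoeff (k q : ℕ) :
    (q : ℚ) * bellCoeff k q = ∑ s ∈ Finset.range k,
      if s + 1 ≤ q then 1 / (s ! : ℚ) * bellCoeff k (q - (s + 1)) else 0 := by
  rcases q with _ | n
  · simp
  · have h : ((n + 1 : ℕ) : ℚ) * bellCoeff k (n + 1) = (restrictedBell (n + 1) k : ℚ) / (n ! : ℚ) := by
      rw [bellCoeff, Nat.factorial_succ]
      have := n.factorial_ne_zero
      push_cast
      field_simp
    rw [h, restrictedBell_succ]
    push_cast
    rw [Finset.sum_div]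
    refine Finset.sum_congr rfl fun s _ => ?_
    split_ifs with hs
    · rw [mul_div_right_comm, choose_div_factorial (by omega), bellCoeff]
      ring
    · rw [Nat.choose_eq_zero_of_lt (by omega)]
      simp

theorem natCast_mul_bell_add (k n m : ℕ) :
    ((n + 1 : ℕ) : ℚ) * ((restrictedBell (n + 1 + m) k : ℚ) / ((n + 1)! * m ! : ℚ)) =
      ∑ s ∈ Finset.range k, ∑ u ∈ Finset.range (s + 1), 1 / (u ! * (s - u)! : ℚ) *
        shiftedValue (fun n m => (restrictedBell (n + m) k : ℚ) / (n ! * m ! : ℚ)) (n + 1) m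
          (u + 1) (s - u) := by
  have h : ((n + 1 : ℕ) : ℚ) * ((restrictedBell (n + 1 + m) k : ℚ) / ((n + 1)! * m ! : ℚ)) =
      (restrictedBell (n + 1 + m) k : ℚ) / (n ! * m ! : ℚ) := by
    rw [Nat.factorial_succ]
    have := n.factorial_ne_zero
    have := m.factorial_ne_zero
    push_cast
    field_simp
  rw [h, add_right_comm, restrictedBell_succ]
  push_cast
  rw [Finset.sum_div]
  refine Finset.sum_congr rfl fun s _ => ?_
  rw [Nat.add_choose_eq, Finset.Nat.sum_antidiagonal_eq_sum_range_succ_mk]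
  push_cast
  rw [Finset.sum_mul, Finset.sum_div]
  refine Finset.sum_congr rfl fun u hu => ?_
  have hus : u ≤ s := Nat.lt_succ_iff.mp (Finset.mem_range.mp hu)
  rw [shiftedValue, Nat.add_sub_add_right]
  split_ifs with h
  · have hu : u ≤ n := by omega
    have e : n + m - s = n - u + (m - (s - u)) := by omega
    calc _ = ((n.choose u : ℚ) / (n ! : ℚ)) * ((m.choose (s - u) : ℚ) / (m ! : ℚ)) *
          (restrictedBell (n + m - s) k : ℚ) := by ring
      _ = _ := by
        rw [choose_div_factorial hu, choose_div_factorial h.2, e]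
        ring
  · rcases not_and_or.mp h with h | h
    · rw [Nat.choose_eq_zero_of_lt (by omega : n < u)]; simp
    · rw [Nat.choose_eq_zero_of_lt (by omega : m < s - u)]; simp

/-- The reciprocal of the product of the factorials of the degrees of a type. -/
def pairCoeff (s u : ℕ) : ℚ := 1 / ((u + 1)! * (s - u)! : ℚ)

/-- The weight of the multiplicity of a position. -/
noncomputable def positionWeight (k : ℕ) : ℕ → ℕ → ℚ :=
  byPosition (bellCoeff k) (bellCoeff k) fun s u q => pairCoeff s u ^ q / (q ! : ℚ)

/-- The coefficients of the recurrence of the weight of a position. -/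
noncomputable def positionCoeff : ℕ → ℕ → ℚ :=
  byPosition (fun s => 1 / (s ! : ℚ)) (fun s => 1 / (s ! : ℚ))
    fun s u r => if r = 0 then pairCoeff s u else 0

theorem natCast_mul_positionWeight {k : ℕ} (hk : 1 ≤ k) :
    ∀ p ∈ typePositions k, ∀ q : ℕ, (q : ℚ) * positionWeight k p q =
      ∑ s ∈ Finset.range k,
        if s + 1 ≤ q then positionCoeff p s * positionWeight k p (q - (s + 1)) else 0 := by
  rw [forall_mem_typePositions]
  refine ⟨natCast_mul_bellCoeff k, natCast_mul_bellCoeff k, fun x hx q => ?_⟩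
  have hx' := (mem_typePairs.mp hx).2
  rw [positionWeight, positionCoeff, byPosition_pairPosition _ _ _ hx',
    byPosition_pairPosition _ _ _ hx', Finset.sum_eq_single 0]
  · rcases q with _ | q
    · simp
    · rw [if_pos (by omega), if_pos rfl, zero_add, Nat.add_sub_cancel, Nat.factorial_succ, pow_succ]
      have := q.factorial_ne_zero
      push_cast
      field_simp
  · intro s _ hs
    simp [hs]
  · intro h
    exact absurd (Finset.mem_range.mpr hk) h

theorem weightedCount_zero_left (k m : ℕ) :
    weightedCount (typePositions k) leftDegree rightDegree (positionWeight k) 0 m =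
      bellCoeff k m := by
  have h : linearSolutions (typePositions k) leftDegree rightDegree 0 m = {Pi.single 2 m} := by
    ext a
    rw [mem_linearSolutions (one_le_degree k), Finset.mem_singleton, sum_typePositions,
      sum_typePositions]
    simp only [leftDegree, rightDegree, byPosition_one, byPosition_two, one_mul, zero_mul,
      zero_add, Nat.add_eq_zero_iff, Finset.sum_eq_zero_iff]
    constructor
    · rintro ⟨h0, ⟨h1, h2⟩, h3⟩
      have h4 : ∀ x ∈ typePairs k, a (pairPosition x) = 0 := by
        intro x hx
        have := h2 x hx
        rw [byPosition_pairPosition _ _ _ (mem_typePairs.mp hx).2] at this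
        simpa using this
      rw [Finset.sum_eq_zero (fun x hx => by rw [h4 x hx, mul_zero]), add_zero] at h3
      funext p
      rcases eq_or_ne p 2 with rfl | hp
      · simpa using h3
      · rw [Pi.single_eq_of_ne hp]
        by_cases hV : p ∈ typePositions k
        · simp only [typePositions, Finset.mem_insert, Finset.mem_image] at hV
          rcases hV with rfl | rfl | ⟨x, hx, rfl⟩
          exacts [h1, absurd rfl hp, h4 x hx]
        · exact h0 p hV
    · rintro rfl
      have h4 : ∀ x : (Σ _ : ℕ, ℕ), (Pi.single 2 m : ℕ → ℕ) (pairPosition x) = 0 := fun x =>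
        Pi.single_eq_of_ne (by rw [pairPosition_eq]; omega) _
      refine ⟨fun p hp => Pi.single_eq_of_ne ?_ _, ⟨by simp, fun x _ => by rw [h4, mul_zero]⟩, ?_⟩
      · rintro rfl
        exact hp (by simp [typePositions])
      · rw [Finset.sum_eq_zero (fun x _ => by rw [h4, mul_zero])]
        simp
  rw [weightedCount, h, Finset.sum_singleton, prod_typePositions]
  have h4 : ∀ x ∈ typePairs k,
      positionWeight k (pairPosition x) ((Pi.single 2 m : ℕ → ℕ) (pairPosition x)) = 1 := by
    intro x hx
    rw [Pi.single_eq_of_ne (by rw [pairPosition_eq]; omega), positionWeight,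
      byPosition_pairPosition _ _ _ (mem_typePairs.mp hx).2]
    simp
  rw [Finset.prod_eq_one h4]
  simp [positionWeight, byPosition_one, byPosition_two, bellCoeff, restrictedBell_zero]

theorem natCast_mul_weightedCount_types {k : ℕ} (hk : 1 ≤ k) (n m : ℕ) :
    (n : ℚ) * weightedCount (typePositions k) leftDegree rightDegree (positionWeight k) n m =
      ∑ s ∈ Finset.range k, ∑ u ∈ Finset.range (s + 1), 1 / (u ! * (s - u)! : ℚ) *
        shiftedValue (weightedCount (typePositions k) leftDegree rightDegree (positionWeight k))
          n m (u + 1) (s - u) := by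
  rw [natCast_mul_weightedCount (one_le_degree k) k _ positionCoeff (natCast_mul_positionWeight hk),
    sum_typePositions]
  set F := weightedCount (typePositions k) leftDegree rightDegree (positionWeight k)
  simp only [Finset.sum_range_succ, Finset.sum_add_distrib]
  rw [add_comm (∑ s ∈ Finset.range k, ∑ u ∈ Finset.range s, _)]
  congr 1
  · simp [leftDegree, rightDegree, positionCoeff, byPosition_one]
  · rw [Finset.sum_sigma', ← typePairs]
    simp only [leftDegree, byPosition_two, Nat.cast_zero, zero_mul, zero_add]
    refine Finset.sum_congr rfl fun x hx => ?_
    have hx' := (mem_typePairs.mp hx).2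
    rw [positionCoeff, rightDegree, byPosition_pairPosition _ _ _ hx',
      byPosition_pairPosition _ _ _ hx', byPosition_pairPosition _ _ _ hx',
      Finset.sum_eq_single 0]
    · rw [if_pos rfl, zero_add, one_mul, one_mul, pairCoeff, ← mul_assoc, Nat.factorial_succ]
      congr 1
      have := x.2.factorial_ne_zero
      push_cast
      field_simp
    · intro s _ hs
      simp [hs]
    · intro h
      exact absurd (Finset.mem_range.mpr hk) h

theorem restrictedBell_add_eq_weightedCount {k : ℕ} (hk : 1 ≤ k) (n m : ℕ) :
    (restrictedBell (n + m) k : ℚ) / (n ! * m ! : ℚ) =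
      weightedCount (typePositions k) leftDegree rightDegree (positionWeight k) n m := by
  refine eq_of_shiftedValue_recurrence ((Finset.range k).sigma fun s => Finset.range (s + 1))
    (fun x => 1 / (x.2 ! * (x.1 - x.2)! : ℚ)) (fun x => x.2 + 1) (fun x => x.1 - x.2)
    (fun _ _ => Nat.succ_pos _)
    (fun n m => (restrictedBell (n + m) k : ℚ) / (n ! * m ! : ℚ)) _ ?_ ?_ ?_ n m
  · intro m
    rw [weightedCount_zero_left]
    simp [bellCoeff]
  · intro n m
    rw [Finset.sum_sigma]
    exact natCast_mul_bell_add k n m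
  · intro n m
    rw [Finset.sum_sigma]
    exact natCast_mul_weightedCount_types hk (n + 1) m

theorem prod_positionWeight (k : ℕ) (a : ℕ → ℕ) :
    ∏ p ∈ typePositions k, positionWeight k p (a p) =
      ((restrictedBell (a 1) k : ℚ) * (restrictedBell (a 2) k : ℚ)) /
        (((a 1)! : ℚ) * ((a 2)! : ℚ) *
          ∏ i ∈ Finset.Icc 2 k, ∏ j ∈ Finset.Icc 1 (i - 1),
            ((j ! : ℚ) ^ a (typeIndex i j) * ((i - j)! : ℚ) ^ a (typeIndex i j) *
              ((a (typeIndex i j))! : ℚ))) := by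
  rw [prod_typePositions, prod_types k (fun i j => ((j ! : ℚ) ^ a (typeIndex i j) *
    ((i - j)! : ℚ) ^ a (typeIndex i j) * ((a (typeIndex i j))! : ℚ)))]
  have h : ∏ x ∈ typePairs k, positionWeight k (pairPosition x) (a (pairPosition x)) =
      (∏ x ∈ typePairs k, (((x.2 + 1)! : ℚ) ^ a (typeIndex (x.1 + 1) (x.2 + 1)) *
        ((x.1 + 1 - (x.2 + 1))! : ℚ) ^ a (typeIndex (x.1 + 1) (x.2 + 1)) *
        ((a (typeIndex (x.1 + 1) (x.2 + 1)))! : ℚ)))⁻¹ := by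
    rw [← Finset.prod_inv_distrib]
    refine Finset.prod_congr rfl fun x hx => ?_
    rw [positionWeight, byPosition_pairPosition _ _ _ (mem_typePairs.mp hx).2, pairPosition,
      pairCoeff, Nat.add_sub_add_right, div_pow, one_pow, mul_pow, div_div, one_div]
  rw [h]
  simp only [positionWeight, byPosition_one, byPosition_two, bellCoeff]
  rw [div_eq_mul_inv, div_eq_mul_inv, div_eq_mul_inv, mul_inv, mul_inv]
  ring

theorem finite_typeVectors {k : ℕ} (hk : 1 ≤ k) (n m : ℕ) : (typeVectors n m k).Finite := by
  rw [← coe_linearSolutions_eq_typeVectors hk]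
  exact Finset.finite_toSet _

theorem restrictedBell_add {k : ℕ} (hk : 1 ≤ k) (n m : ℕ) :
    (restrictedBell (n + m) k : ℚ) =
      (n ! : ℚ) * (m ! : ℚ) *
        ∑ᶠ a ∈ typeVectors n m k,
          ((restrictedBell (a 1) k : ℚ) * (restrictedBell (a 2) k : ℚ)) /
            (((a 1)! : ℚ) * ((a 2)! : ℚ) *
              ∏ i ∈ Finset.Icc 2 k, ∏ j ∈ Finset.Icc 1 (i - 1),
                ((j ! : ℚ) ^ a (typeIndex i j) * ((i - j)! : ℚ) ^ a (typeIndex i j) *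
                  ((a (typeIndex i j))! : ℚ))) := by
  rw [← coe_linearSolutions_eq_typeVectors hk]
  simp only [← prod_positionWeight]
  rw [finsum_mem_coe_finset, ← weightedCount, ← restrictedBell_add_eq_weightedCount hk]
  have := n.factorial_ne_zero
  have := m.factorial_ne_zero
  field_simp

theorem ceil_half_le_iff (i j : ℕ) : ⌈(i : ℚ) / 2⌉₊ ≤ j ↔ i ≤ 2 * j := by
  rw [Nat.ceil_le, div_le_iff₀ (by norm_num), mul_comm]
  exact_mod_cast Iff.rfl

theorem mem_tripleRange {i j l : ℕ} : l ∈ tripleRange i j ↔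
    (l ≤ i ∧ l ≤ j ∧ l ≤ 2 * i - j ∧ l ≤ 2 * j - i) ∧ (l : ℤ) % 3 = (-(i : ℤ) - j) % 3 := by
  refine Finset.mem_filter.trans (and_congr ?_ Iff.rfl)
  simp

/-- The triples `(i, j, l)` over which the formulas for blocks of at most three elements sum. -/
def triples (n m : ℕ) : Finset (Σ _ : ℕ, Σ _ : ℕ, ℕ) :=
  (Finset.Icc 0 n).sigma fun i =>
    (Finset.Icc ⌈(i : ℚ) / 2⌉₊ (min m (2 * i))).sigma fun j => tripleRange i j

theorem mem_triples {n m : ℕ} {x : Σ _ : ℕ, Σ _ : ℕ, ℕ} :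
    x ∈ triples n m ↔ x.1 ≤ n ∧ x.2.1 ≤ m ∧
      x.1 = x.2.2 + 2 * tripleCount x.2.2 x.1 x.2.1 + tripleCount x.2.2 x.2.1 x.1 ∧
      x.2.1 = x.2.2 + tripleCount x.2.2 x.1 x.2.1 + 2 * tripleCount x.2.2 x.2.1 x.1 := by
  obtain ⟨i, j, l⟩ := x
  simp only [triples, Finset.mem_sigma, Finset.mem_Icc, ceil_half_le_iff, mem_tripleRange,
    le_min_iff, tripleCount]
  omega

theorem mem_typeVectors_three {n m : ℕ} {a : ℕ → ℕ} :
    a ∈ typeVectors n m 3 ↔ (∀ p, p ∉ Finset.Icc 1 5 → a p = 0) ∧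
      a 1 + (a 3 + (a 4 + 2 * a 5)) = n ∧ a 2 + (a 3 + (2 * a 4 + a 5)) = m := by
  have h2 : Finset.Icc 2 3 = {2, 3} := by decide
  have h3 : Finset.Icc 1 2 = {1, 2} := by decide
  simp [typeVectors, typeIndex, h2, h3]

/-- The vector of types that corresponds to a triple. -/
def tripleVector (n m : ℕ) (x : Σ _ : ℕ, Σ _ : ℕ, ℕ) (p : ℕ) : ℕ :=
  if p = 1 then n - x.1 else if p = 2 then m - x.2.1 else if p = 3 then x.2.2
  else if p = 4 then tripleCount x.2.2 x.2.1 x.1 else if p = 5 then tripleCount x.2.2 x.1 x.2.1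
  else 0

theorem restrictedBell_add_three (n m : ℕ) :
    (restrictedBell (n + m) 3 : ℚ) =
      ∑ i ∈ Finset.Icc 0 n, ∑ j ∈ Finset.Icc ⌈(i : ℚ) / 2⌉₊ (min m (2 * i)),
        ∑ l ∈ tripleRange i j,
          ((n ! : ℚ) * (m ! : ℚ) * (restrictedBell (n - i) 3 : ℚ) *
              (restrictedBell (m - j) 3 : ℚ)) /
            ((l ! : ℚ) * ((n - i)! : ℚ) * ((m - j)! : ℚ) * ((tripleCount l i j)! : ℚ) *
              ((tripleCount l j i)! : ℚ) * (2 : ℚ) ^ ((i + j - 2 * l) / 3)) := by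
  have h2 : Finset.Icc 2 3 = {2, 3} := by decide
  have h3 : Finset.Icc 1 2 = {1, 2} := by decide
  rw [restrictedBell_add (by norm_num : 1 ≤ 3), finsum_mem_eq_finite_toFinset_sum _
    (finite_typeVectors (by norm_num : 1 ≤ 3) n m), Finset.mul_sum]
  simp only [Finset.sum_sigma']
  symm
  refine Finset.sum_nbij' (s := triples n m) (tripleVector n m)
    (fun a => ⟨n - a 1, m - a 2, a 3⟩) ?_ ?_ ?_ ?_ ?_
  · intro x hx
    rw [mem_triples] at hx
    rw [Set.Finite.mem_toFinset, mem_typeVectors_three]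
    refine ⟨fun p hp => ?_, ?_, ?_⟩
    · rw [Finset.mem_Icc] at hp
      simp only [tripleVector]
      split_ifs <;> first | rfl | omega
    · simp only [tripleVector]
      norm_num
      omega
    · simp only [tripleVector]
      norm_num
      omega
  · intro a ha
    rw [Set.Finite.mem_toFinset, mem_typeVectors_three] at ha
    rw [mem_triples]
    simp only [tripleCount]
    omega
  · intro x hx
    rw [mem_triples] at hx
    obtain ⟨i, j, l⟩ := x
    simp only [tripleVector] at hx ⊢
    norm_num
    rw [Nat.sub_sub_self hx.1, Nat.sub_sub_self hx.2.1]
    exact ⟨rfl, rfl⟩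
  · intro a ha
    rw [Set.Finite.mem_toFinset, mem_typeVectors_three] at ha
    obtain ⟨h0, h1, h2⟩ := ha
    funext p
    simp only [tripleVector, tripleCount]
    split_ifs with h1 h2 h3 h4 h5
    · subst h1; omega
    · subst h2; omega
    · subst h3; omega
    · subst h4; omega
    · subst h5; omega
    · exact (h0 p (by rw [Finset.mem_Icc]; omega)).symm
  · intro x hx
    rw [mem_triples] at hx
    obtain ⟨i, j, l⟩ := x
    simp only at hx
    have e : (i + j - 2 * l) / 3 = tripleCount l i j + tripleCount l j i := by omega
    simp only [e, h2]
    simp [tripleVector, typeIndex, h3, pow_add]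
    field_simp

theorem choose_mul_choose_three (n m l a b : ℕ) (hi : l + 2 * a + b ≤ n)
    (hj : l + a + 2 * b ≤ m) (x y : ℚ) :
    (n.choose (l + 2 * a + b) : ℚ) * x * ((m.choose (l + a + 2 * b) : ℚ) * y *
      (((l + 2 * a + b).choose l : ℚ) * ((l + a + 2 * b).choose l : ℚ) * (l ! : ℚ) *
        ((l + 2 * a + b - l).choose b : ℚ) * ((l + a + 2 * b - l).choose a : ℚ) *
          (((2 * a)! : ℚ) * ((2 * b)! : ℚ) / (2 : ℚ) ^ (a + b)))) =
      ((n ! : ℚ) * (m ! : ℚ) * x * y) /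
        ((l ! : ℚ) * ((n - (l + 2 * a + b))! : ℚ) * ((m - (l + a + 2 * b))! : ℚ) * (a ! : ℚ) *
          (b ! : ℚ) * (2 : ℚ) ^ (a + b)) := by
  rw [Nat.cast_choose ℚ hi, Nat.cast_choose ℚ hj,
    Nat.cast_choose ℚ (by omega : l ≤ l + 2 * a + b),
    Nat.cast_choose ℚ (by omega : l ≤ l + a + 2 * b),
    Nat.cast_choose ℚ (by omega : b ≤ l + 2 * a + b - l),
    Nat.cast_choose ℚ (by omega : a ≤ l + a + 2 * b - l),
    show l + 2 * a + b - l - b = 2 * a by omega, show l + a + 2 * b - l - a = 2 * b by omega]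
  have := fun p : ℕ => (Nat.cast_ne_zero (R := ℚ)).mpr p.factorial_ne_zero
  have h1 := this (l + 2 * a + b)
  have h2 := this (l + a + 2 * b)
  have h3 := this (l + 2 * a + b - l)
  have h4 := this (l + a + 2 * b - l)
  have h5 := this (2 * a)
  have h6 := this (2 * b)
  have h7 := this l
  have h8 := this a
  have h9 := this b
  have h10 := this (n - (l + 2 * a + b))
  have h11 := this (m - (l + a + 2 * b))
  field_simp

theorem sum_choose_mul_choose_three (n m : ℕ) (f : ℕ → ℚ) :
    ∑ i ∈ Finset.Icc 0 n, (n.choose i : ℚ) * f (n - i) *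
        ∑ j ∈ Finset.Icc ⌈(i : ℚ) / 2⌉₊ (min m (2 * i)),
          (m.choose j : ℚ) * f (m - j) *
            ∑ l ∈ tripleRange i j,
              (i.choose l : ℚ) * (j.choose l : ℚ) * (l ! : ℚ) *
                ((i - l).choose (tripleCount l j i) : ℚ) *
                ((j - l).choose (tripleCount l i j) : ℚ) *
                (((2 * tripleCount l i j)! : ℚ) * ((2 * tripleCount l j i)! : ℚ) /
                  (2 : ℚ) ^ (tripleCount l i j + tripleCount l j i)) =
      ∑ i ∈ Finset.Icc 0 n, ∑ j ∈ Finset.Icc ⌈(i : ℚ) / 2⌉₊ (min m (2 * i)),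
        ∑ l ∈ tripleRange i j,
          ((n ! : ℚ) * (m ! : ℚ) * f (n - i) * f (m - j)) /
            ((l ! : ℚ) * ((n - i)! : ℚ) * ((m - j)! : ℚ) * ((tripleCount l i j)! : ℚ) *
              ((tripleCount l j i)! : ℚ) * (2 : ℚ) ^ ((i + j - 2 * l) / 3)) := by
  refine Finset.sum_congr rfl fun i hi => ?_
  rw [Finset.mul_sum]
  refine Finset.sum_congr rfl fun j hj => ?_
  rw [Finset.mul_sum, Finset.mul_sum]
  refine Finset.sum_congr rfl fun l hl => ?_
  have hx : (⟨i, j, l⟩ : Σ _ : ℕ, Σ _ : ℕ, ℕ) ∈ triples n m :=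
    Finset.mem_sigma.mpr ⟨hi, Finset.mem_sigma.mpr ⟨hj, hl⟩⟩
  rw [mem_triples] at hx
  simp only at hx
  obtain ⟨hin, hjm, ei, ej⟩ := hx
  have e : (i + j - 2 * l) / 3 = tripleCount l i j + tripleCount l j i := by omega
  rw [e]
  generalize tripleCount l i j = a at *
  generalize tripleCount l j i = b at *
  subst ei ej
  exact choose_mul_choose_three n m l a b hin hjm _ _

theorem theorem4p3 :
    (∀ n m k : ℕ, 1 ≤ k →
      (typeVectors n m k).Finite ∧
      (restrictedBell (n + m) k : ℚ) =
        (n ! : ℚ) * (m ! : ℚ) *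
          ∑ᶠ a ∈ typeVectors n m k,
            ((restrictedBell (a 1) k : ℚ) * (restrictedBell (a 2) k : ℚ)) /
              (((a 1)! : ℚ) * ((a 2)! : ℚ) *
                ∏ i ∈ Finset.Icc 2 k, ∏ j ∈ Finset.Icc 1 (i - 1),
                  ((j ! : ℚ) ^ a (typeIndex i j) * ((i - j)! : ℚ) ^ a (typeIndex i j) *
                    ((a (typeIndex i j))! : ℚ)))) ∧
    (∀ n m : ℕ,
      (restrictedBell (n + m) 3 : ℚ) =
        ∑ i ∈ Finset.Icc 0 n, (n.choose i : ℚ) * (restrictedBell (n - i) 3 : ℚ) *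
          ∑ j ∈ Finset.Icc ⌈(i : ℚ) / 2⌉₊ (min m (2 * i)),
            (m.choose j : ℚ) * (restrictedBell (m - j) 3 : ℚ) *
              ∑ l ∈ tripleRange i j,
                (i.choose l : ℚ) * (j.choose l : ℚ) * (l ! : ℚ) *
                  ((i - l).choose (tripleCount l j i) : ℚ) *
                  ((j - l).choose (tripleCount l i j) : ℚ) *
                  (((2 * tripleCount l i j)! : ℚ) * ((2 * tripleCount l j i)! : ℚ) /
                    (2 : ℚ) ^ (tripleCount l i j + tripleCount l j i)) ∧
      (restrictedBell (n + m) 3 : ℚ) =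
        ∑ i ∈ Finset.Icc 0 n, ∑ j ∈ Finset.Icc ⌈(i : ℚ) / 2⌉₊ (min m (2 * i)),
          ∑ l ∈ tripleRange i j,
            ((n ! : ℚ) * (m ! : ℚ) * (restrictedBell (n - i) 3 : ℚ) *
                (restrictedBell (m - j) 3 : ℚ)) /
              ((l ! : ℚ) * ((n - i)! : ℚ) * ((m - j)! : ℚ) * ((tripleCount l i j)! : ℚ) *
                ((tripleCount l j i)! : ℚ) * (2 : ℚ) ^ ((i + j - 2 * l) / 3))) := by
  refine ⟨fun n m k hk => ⟨finite_typeVectors hk n m, restrictedBell_add hk n m⟩, fun n m =>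
    ⟨?_, restrictedBell_add_three n m⟩⟩
  rw [sum_choose_mul_choose_three n m fun q => (restrictedBell q 3 : ℚ)]
  exact restrictedBell_add_three n m
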